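/- Let $E$ be a finite set with a linear order, $E=\{e_1\prec\cdots\prec e_r\}$, let $\mathbb K$ be a field, and let $\mathcal L\subseteq\{+,-,0\}^E$ be (the set of covectors of) an oriented matroid on $E$. Let $\mathcal T$ be its set of topes, i.e. the covectors that are maximal in the product order induced by $0<+,-$. For sign vectors $P,Q$ put $\mathrm{Sep}(P,Q)=\{e\in E : P_e=-Q_e\neq 0\}$. The Varchenko matrix $\mathfrak V$ is the $\mathcal T\times\mathcal T$ matrix over $\mathbb K[U_e : e\in E]$ with entries $\mathfrak V_{P,Q}=\prod_{e\in \mathrm{Sep}(P,Q)}U_e$. For $R\in\mathcal T$ and $e\in E$ let $\mathcal T_{R,e}$ be the poset consisting of the topes $T$ with $T_e=-R_e$, ordered by $P\preceq_R Q$ if and only if $\mathrm{Sep}(R,P)\subseteq \mathrm{Sep}(R,Q)$, together with an additional least element $\hat 0$. For such a tope $Q$ let $\mu((\hat 0,Q)_{R,e})$ be the Möbius number of the open interval from $\hat 0$ to $Q$, i.e. the value $\mu(\hat 0,Q)$ of the Möbius function of $\mathcal T_{R,e}$. For $e\in E$ let $M^e$ be the matrix with rows indexed by the topes $Q$ with $Q_e=-$,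 columns indexed by the topes $R$ with $R_e=+$, and entries $$M^e_{Q,R}=\begin{cases}-\mu((\hat 0,Q)_{R,e})\cdot\mathfrak V_{Q,R} & \text{if } e \text{ is the largest element of } \mathrm{Sep}(Q,R),\\ 0 & \text{otherwise.}\end{cases}$$ Let $\mathcal M^e$ be the $\mathcal T\times\mathcal T$ matrix $$\mathcal M^e=\begin{pmatrix} I & M^e\\ M^e & I\end{pmatrix},$$ where the first block of rows and columns is indexed by the topes that are negative at $e$, the second one by the topes that are positive at $e$, and the two sets of topes are matched by $T\mapsto -T$. That is, $\mathcal M^e_{Q,R}=M^e_{Q,R}$ if $Q_e=-$ and $R_e=+$; $\mathcal M^e_{Q,R}=M^e_{-Q,-R}$ if $Q_e=+$ and $R_e=-$; and in all other cases $\mathcal M^e_{Q,R}$ is $1$ if $Q=R$ and $0$ if $Q\ne R$. (If $e$ is a loop, $\mathcal M^e$ is the identity matrix.) Then $$\mathfrak V=\mathcal M^{e_1}\cdots\mathcal M^{e_r}.$$ -/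

import Mathlib

/-- An oriented matroid on the ground set `E`, given by its set of covectors: sign vectors
`E → {+, -, 0}` satisfying the covector axioms. -/
structure OrientedMatroid (E : Type*) where
  /-- the set of covectors -/
  covectors : Set (E → SignType)
  zero_mem : (0 : E → SignType) ∈ covectors
  neg_mem : ∀ X ∈ covectors, -X ∈ covectors
  /-- closure under composition: `(X ∘ Y)_e = X_e` if `X_e ≠ 0`, and `Y_e` otherwise -/
  comp_mem : ∀ X ∈ covectors, ∀ Y ∈ covectors,
    (fun e => if X e = 0 then Y e else X e) ∈ covectors
  /-- covector elimination: for every `e` separating `X` and `Y` there is a covector `Z` with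
  `Z_e = 0` which agrees with `X ∘ Y` at all elements not separating `X` and `Y` -/
  elim : ∀ X ∈ covectors, ∀ Y ∈ covectors, ∀ e, X e = -Y e → X e ≠ 0 →
    ∃ Z ∈ covectors, Z e = 0 ∧
      ∀ f, ¬ (X f = -Y f ∧ X f ≠ 0) → Z f = if X f = 0 then Y f else X f

namespace OrientedMatroid

/-- The order on sign vectors: the product order induced by `0 < +` and `0 < -`. -/
def CovectorLE {E : Type*} (X Y : E → SignType) : Prop :=
  ∀ e, X e = 0 ∨ X e = Y e

/-- A tope is a maximal covector. -/
def IsTope {E : Type*} (L : OrientedMatroid E) (T : E → SignType) : Prop :=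
  T ∈ L.covectors ∧ ∀ X ∈ L.covectors, CovectorLE T X → X = T

/-- The type of topes. -/
abbrev Tope {E : Type*} (L : OrientedMatroid E) : Type _ :=
  {T : E → SignType // L.IsTope T}

noncomputable instance {E : Type*} [Fintype E] (L : OrientedMatroid E) : Fintype L.Tope :=
  Fintype.ofFinite _

theorem IsTope.neg {E : Type*} {L : OrientedMatroid E} {T : E → SignType} (hT : L.IsTope T) :
    L.IsTope (-T) := by
  refine ⟨L.neg_mem T hT.1, fun X hX h => ?_⟩
  have h1 := hT.2 (-X) (L.neg_mem X hX) (fun e => by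
    rcases h e with h0 | h0
    · left
      simpa using h0
    · right
      simp [← h0])
  rw [← h1, neg_neg]

/-- The negative `-T` of a tope `T`. -/
instance {E : Type*} (L : OrientedMatroid E) : Neg L.Tope :=
  ⟨fun T => ⟨-T.1, T.2.neg⟩⟩

theorem IsTope.ne_zero {E : Type*} {L : OrientedMatroid E} {S T : E → SignType}
    (hS : L.IsTope S) (hT : L.IsTope T) {e : E} (h : T e ≠ 0) : S e ≠ 0 := by
  intro h0
  have h1 := hS.2 _ (L.comp_mem S hS.1 T hT.1) (fun f => by
    by_cases hf : S f = 0
    · exact Or.inl hf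
    · right
      simp [hf])
  have h2 := congrFun h1 e
  simp [h0] at h2
  exact h h2

/-- The separator `Sep(X, Y)`, the set of all `e` with `X_e = -Y_e ≠ 0`. -/
def sep {E : Type*} [Fintype E] (X Y : E → SignType) : Finset E :=
  Finset.univ.filter fun e => X e = -Y e ∧ X e ≠ 0

/-- The set of topes, to be ordered with respect to the base tope `R`. -/
def TopePoset {E : Type*} (L : OrientedMatroid E) (_R : L.Tope) : Type _ := L.Tope

instance {E : Type*} [Fintype E] (L : OrientedMatroid E) (R : L.Tope) :
    Finite (L.TopePoset R) :=
  inferInstanceAs (Finite L.Tope)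

theorem eq_of_sep_eq {E : Type*} [Fintype E] {L : OrientedMatroid E} {R P Q : E → SignType}
    (hR : L.IsTope R) (hP : L.IsTope P) (hQ : L.IsTope Q) (h : sep R P = sep R Q) : P = Q := by
  funext e
  have he : e ∈ sep R P ↔ e ∈ sep R Q := by rw [h]
  simp only [sep, Finset.mem_filter, Finset.mem_univ, true_and] at he
  have h1 : R e ≠ 0 → P e ≠ 0 := fun h0 => hP.ne_zero hR h0
  have h2 : R e ≠ 0 → Q e ≠ 0 := fun h0 => hQ.ne_zero hR h0
  have h3 : P e ≠ 0 → R e ≠ 0 := fun h0 => hR.ne_zero hP h0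
  have h4 : Q e ≠ 0 → R e ≠ 0 := fun h0 => hR.ne_zero hQ h0
  revert he h1 h2 h3 h4
  generalize R e = r
  generalize P e = p
  generalize Q e = q
  revert r p q
  decide

/-- The tope poset with base tope `R`: `P ≼ Q` if and only if `Sep(R, P) ⊆ Sep(R, Q)`. -/
instance {E : Type*} [Fintype E] (L : OrientedMatroid E) (R : L.Tope) :
    PartialOrder (L.TopePoset R) where
  le P Q := sep R.1 P.1 ⊆ sep R.1 Q.1
  le_refl _ := Finset.Subset.refl _
  le_trans _ _ _ h1 h2 := Finset.Subset.trans h1 h2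
  le_antisymm P Q h1 h2 :=
    Subtype.ext (eq_of_sep_eq R.2 P.2 Q.2 (Finset.Subset.antisymm h1 h2))

/-- The poset `T_{R,e}`: the topes `T` with `T_e = -R_e`, ordered as in the tope poset with base
tope `R`, together with an additional least element `⊥`, written `0̂`. -/
abbrev OppositePoset {E : Type*} (L : OrientedMatroid E) (R : L.Tope) (e : E) : Type _ :=
  WithBot {T : L.TopePoset R // T.1 e = -R.1 e}

open Classical in
noncomputable instance {E : Type*} [Fintype E] (L : OrientedMatroid E) (R : L.Tope) (e : E) :
    LocallyFiniteOrder (L.OppositePoset R e) :=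
  letI : Fintype (L.OppositePoset R e) := Fintype.ofFinite (Option _)
  Fintype.toLocallyFiniteOrder

open Classical in
/-- The Möbius number `μ((0̂, P)_{R,e})` of the open interval from `0̂` to `P` in `T_{R,e}`, i.e.
the value `μ(0̂, P)` of the Möbius function of the poset `T_{R,e}`. -/
noncomputable def moebius {E : Type*} [Fintype E] (L : OrientedMatroid E) (R : L.Tope) (e : E)
    (P : L.Tope) (hP : P.1 e = -R.1 e) : ℤ :=
  IncidenceAlgebra.mu ℤ (⊥ : L.OppositePoset R e)
    ((⟨P, hP⟩ : {T : L.TopePoset R // T.1 e = -R.1 e}) : L.OppositePoset R e)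

/-- The Varchenko matrix, with entries `V_{P,Q} = ∏_{e ∈ Sep(P,Q)} U_e`. -/
noncomputable def varchenko (K : Type*) [Field K] {E : Type*} [Fintype E]
    (L : OrientedMatroid E) : Matrix L.Tope L.Tope (MvPolynomial E K) :=
  fun P Q => ∏ e ∈ sep P.1 Q.1, MvPolynomial.X e

/-- The topes `T` with `T_e = +`. -/
abbrev PosTope {E : Type*} (L : OrientedMatroid E) (e : E) : Type _ :=
  {T : L.Tope // T.1 e = 1}

/-- The topes `T` with `T_e = -`. -/
abbrev NegTope {E : Type*} (L : OrientedMatroid E) (e : E) : Type _ :=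
  {T : L.Tope // T.1 e = -1}

open Classical in
/-- The block `M^e`, with rows indexed by the topes that are negative at `e` and columns indexed
by the topes that are positive at `e`. -/
noncomputable def block (K : Type*) [Field K] {E : Type*} [Fintype E] [LinearOrder E]
    (L : OrientedMatroid E) (e : E) :
    Matrix (L.NegTope e) (L.PosTope e) (MvPolynomial E K) :=
  fun Q R =>
    if IsGreatest (sep Q.1.1 R.1.1 : Set E) e then
      -(L.moebius R.1 e Q.1 (by rw [Q.2, R.2]) : MvPolynomial E K) * L.varchenko K Q.1 R.1
    else 0

open Classical in
/-- The factor `[[I, M^e], [M^e, I]]` as a matrix indexed by all topes. In the upper right block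
the rows are the topes negative at `e` and the columns the topes positive at `e`. In the lower left
block, whose rows are the topes positive at `e` and whose columns are the topes negative at `e`,
the entries of `M^e` are placed by means of the bijection `T ↦ -T` between the two halves.
(If `e` is a loop, both halves are empty and the factor is the identity matrix.) -/
noncomputable def factor (K : Type*) [Field K] {E : Type*} [Fintype E] [LinearOrder E]
    (L : OrientedMatroid E) (e : E) : Matrix L.Tope L.Tope (MvPolynomial E K) :=
  fun Q R =>
    if h : Q.1 e = -1 ∧ R.1 e = 1 then
      L.block K e ⟨Q, h.1⟩ ⟨R, h.2⟩
    else if h : Q.1 e = 1 ∧ R.1 e = -1 then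
      L.block K e ⟨-Q, congrArg Neg.neg h.1⟩ ⟨-R, congrArg Neg.neg h.2⟩
    else if Q = R then 1
    else 0

end OrientedMatroid

/-! Let `V_S` be the Varchenko matrix with all `U_f`, `f ∉ S`, set to zero. Then `V_∅ = 1`,
`V_E` is the Varchenko matrix, and the factorization follows from the one-step identity
`V_{< e} * factor e = V_{≤ e}` (`truncatedVarchenko_mul_factor`).

Compare the entries at `(P, R)`. If `P` and `R` lie on the same side of `e`, only the diagonal term
survives. Otherwise `V_{P,Q} V_{Q,R} = V_{P,R} ∏ U_f ^ 2`, with the product over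
`f ∈ Sep(R,Q) \ Sep(R,P)`, so the claim is that, among the topes `Q` beyond `e` with `Sep(R,Q)`
contained in `{f | f ≤ e}`, the numbers `-μ(0̂,Q)` sum to `1` over those with
`Sep(R,Q) \ Sep(R,P) = ∅` and to `0` over those with `Sep(R,Q) \ Sep(R,P) = D`, for every other
`D`. By Möbius inversion over the subsets `D` this amounts to the following statement
(`sum_oppositeWeight`): for every set `B` such that some tope `Q` with `Q_e = -R_e` has
`Sep(R,Q) ⊆ B`, the numbers `-μ(0̂,Q)` of all these `Q` add up to `1`. In other words, the topes
beyond `e` inside a cone around `R` form a poset of Euler characteristic `1`.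

To see this, pass to the covectors `F` with `F_e = -R_e`, and give them the weight `w` that sums to
`1` over every principal lower set. Then `w` sums to `1` over every nonempty set cut out by sign
conditions `F_f ∈ c_f` with `0 ∈ c_f` (`sum_cell`). If no `c_f` contains both signs, composition
shows that the set has a greatest element. Otherwise the set is split along some `f` into the
parts with `F_f ≥ 0` and `F_f ≤ 0`; if both signs occur, covector elimination makes the common part
`F_f = 0` nonempty, and inclusion-exclusion gives `1 + 1 - 1 = 1`. Finally, `F ↦ F ∘ R` maps these
covectors to the topes beyond `e`, with `Sep(R, F ∘ R) = Sep(R, F)`. Hence the pushforward of `w`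
sums to `1` over every principal lower set of topes, which identifies it with `-μ(0̂, ·)`, and its
sums over cones are instances of `sum_cell`. -/

namespace OrientedMatroid

/-! ### Möbius functions of finite posets with a bottom element adjoined -/

section Poset

variable {α : Type*} [Fintype α] [PartialOrder α]

open Classical in
theorem sum_neg_mu_bot [LocallyFiniteOrder (WithBot α)] (x : α) :
    ∑ y with y ≤ x, -IncidenceAlgebra.mu ℤ (⊥ : WithBot α) y = 1 := by
  have h := IncidenceAlgebra.sum_Icc_mu_right (𝕜 := ℤ) (⊥ : WithBot α) (x : WithBot α)
  have hI : Finset.Icc (⊥ : WithBot α) x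
      = insert ⊥ ((Finset.univ.filter fun y : α => y ≤ x).map ⟨_, WithBot.coe_injective⟩) := by
    ext y
    induction y using WithBot.recBotCoe with
    | bot => simp
    | coe y =>
      simp only [Finset.mem_Icc, bot_le, WithBot.coe_le_coe, true_and, Finset.mem_insert,
        WithBot.coe_ne_bot, false_or, Finset.mem_map, Finset.mem_filter, Finset.mem_univ]
      constructor
      · intro h
        exact ⟨y, h, rfl⟩
      · rintro ⟨z, hz, hzy⟩
        exact WithBot.coe_injective hzy ▸ hz
  rw [hI, Finset.sum_insert (by simp), Finset.sum_map] at h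
  simp only [IncidenceAlgebra.mu_self] at h
  rw [if_neg (WithBot.bot_ne_coe)] at h
  rw [Finset.sum_neg_distrib]
  change 1 + ∑ y with y ≤ x, IncidenceAlgebra.mu ℤ (⊥ : WithBot α) y = 0 at h
  linarith

open Classical in
/-- A function on a finite poset is determined by its sums over principal lower sets. -/
theorem eq_of_sum_le_eq {f g : α → ℤ}
    (h : ∀ x, ∑ y with y ≤ x, f y = ∑ y with y ≤ x, g y) : f = g := by
  funext x
  induction x using WellFoundedLT.induction with
  | ind x ih =>
    have hs : (Finset.univ.filter fun y : α => y ≤ x)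
        = insert x (Finset.univ.filter fun y : α => y < x) := by
      ext y
      simp [le_iff_eq_or_lt]
    have hx := h x
    rw [hs, Finset.sum_insert (by simp), Finset.sum_insert (by simp),
      Finset.sum_congr rfl fun y hy => ih y (by simpa using hy)] at hx
    exact add_right_cancel hx

end Poset

/-- Sign vectors, as a type separate from `E → SignType`: the latter already carries the pointwise
order with `-1 < 0 < 1`, whereas `SignVector E` is ordered by `CovectorLE`. -/
def SignVector (E : Type*) : Type _ := E → SignType

instance {E : Type*} : PartialOrder (SignVector E) where
  le X Y := CovectorLE X Y
  le_refl _ _ := Or.inr rfl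
  le_trans X Y Z h1 h2 e := by
    rcases h1 e with h | h
    · exact Or.inl h
    · rw [h]
      exact h2 e
  le_antisymm X Y h1 h2 := by
    funext e
    rcases h1 e with h | h
    · rcases h2 e with h' | h'
      · rw [h, h']
      · exact h'.symm
    · exact h

/-! ### Euler characteristics of sets of covectors -/

section Weight

variable {E : Type*} [Fintype E] [DecidableEq E]

open Classical in
/-- The weight is `-μ(⊥, ·)` for the poset of sign vectors satisfying `p` with `⊥` adjoined; its sum
over a lower set is the Euler characteristic of that lower set. -/
theorem exists_weight (p : (E → SignType) → Prop) :
    ∃ w : (E → SignType) → ℤ, ∀ F, p F → ∑ G with p G ∧ CovectorLE G F, w G = 1 := by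
  let α := {F : SignVector E // p F}
  let _ : Fintype (SignVector E) := inferInstanceAs (Fintype (E → SignType))
  let _ : Fintype α := @Fintype.ofFinite α Subtype.finite
  let _ : Fintype (WithBot α) := inferInstanceAs (Fintype (Option α))
  let _ : LocallyFiniteOrder (WithBot α) := Fintype.toLocallyFiniteOrder
  refine ⟨fun G => if h : p G then
    -IncidenceAlgebra.mu ℤ (⊥ : WithBot α) ((⟨G, h⟩ : α) : WithBot α) else 0, fun F hF => ?_⟩
  rw [← sum_neg_mu_bot (⟨F, hF⟩ : α)]
  symm
  refine Finset.sum_bij (fun (G : α) _ => (G.1 : E → SignType)) ?_ ?_ ?_ ?_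
  · intro G hG
    simp only [Finset.mem_filter, Finset.mem_univ, true_and] at hG
    exact Finset.mem_filter.2 ⟨Finset.mem_univ _, G.2, hG⟩
  · intro G _ G' _ h
    exact Subtype.ext h
  · intro G hG
    simp only [Finset.mem_filter, Finset.mem_univ, true_and] at hG
    exact ⟨⟨G, hG.1⟩, by simpa using (show (⟨G, hG.1⟩ : α) ≤ ⟨F, hF⟩ from hG.2), rfl⟩
  · intro G _
    rw [dif_pos G.2]

variable (L : OrientedMatroid E)

open Classical in
/-- The covectors with value `s` at `e` whose value at each `f` lies in `c f`. With `0 ∈ c f` for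
all `f`, this is the part of the open half-space `F e = s` lying in an intersection of closed
half-spaces and hyperplanes. -/
noncomputable def cell (e : E) (s : SignType) (c : E → Set SignType) : Finset (E → SignType) :=
  Finset.univ.filter fun F => F ∈ L.covectors ∧ F e = s ∧ ∀ f, F f ∈ c f

variable {L}

theorem mem_cell {e : E} {s : SignType} {c : E → Set SignType} {F : E → SignType} :
    F ∈ L.cell e s c ↔ F ∈ L.covectors ∧ F e = s ∧ ∀ f, F f ∈ c f := by
  simp [cell]

theorem mem_cell_update {e : E} {s : SignType} {c : E → Set SignType} {f : E} {a : Set SignType}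
    (ha : a ⊆ c f) {F : E → SignType} :
    F ∈ L.cell e s (Function.update c f a) ↔ F ∈ L.cell e s c ∧ F f ∈ a := by
  simp only [mem_cell]
  constructor
  · rintro ⟨h1, h2, h3⟩
    have hf : F f ∈ a := by simpa using h3 f
    refine ⟨⟨h1, h2, fun g => ?_⟩, hf⟩
    by_cases hg : g = f
    · subst hg
      exact ha hf
    · simpa [hg] using h3 g
  · rintro ⟨⟨h1, h2, h3⟩, h4⟩
    refine ⟨h1, h2, fun g => ?_⟩
    by_cases hg : g = f
    · subst hg
      simpa using h4
    · simpa [hg] using h3 g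

theorem sign_cases {a b : SignType} (ha : a ≠ 0) (hab : a ≠ b) (hb : b ≠ 0) :
    a = 1 ∧ b = -1 ∨ a = -1 ∧ b = 1 := by
  revert a b
  decide

/-- If no two members of the cell are separated by an element, the cell is closed under composition,
and a member of maximal support is its greatest element. -/
theorem exists_greatest_of_cell {e : E} {s : SignType} {c : E → Set SignType}
    (hc : ∀ f, ¬ (1 ∈ c f ∧ -1 ∈ c f)) (hne : (L.cell e s c).Nonempty) :
    ∃ M ∈ L.cell e s c, ∀ F ∈ L.cell e s c, CovectorLE F M := by
  obtain ⟨M, hM, hmax⟩ := Finset.exists_max_image (L.cell e s c)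
    (fun F => (Finset.univ.filter fun f => F f ≠ 0).card) hne
  refine ⟨M, hM, fun F hF => ?_⟩
  have hM' := mem_cell.1 hM
  have hF' := mem_cell.1 hF
  have hcomp : (fun f => if M f = 0 then F f else M f) ∈ L.cell e s c := by
    refine mem_cell.2 ⟨L.comp_mem M hM'.1 F hF'.1, ?_, fun f => ?_⟩
    · rw [hM'.2.1, hF'.2.1, ite_self]
    · split_ifs
      exacts [hF'.2.2 f, hM'.2.2 f]
  have hsub : (Finset.univ.filter fun f => M f ≠ 0) ⊆
      Finset.univ.filter fun f => (if M f = 0 then F f else M f) ≠ 0 := by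
    intro f hf
    simp only [Finset.mem_filter, Finset.mem_univ, true_and] at hf ⊢
    rwa [if_neg hf]
  have heq := Finset.eq_of_subset_of_card_le hsub (hmax _ hcomp)
  intro f
  by_cases h0 : F f = 0
  · exact Or.inl h0
  right
  have hMf : M f ≠ 0 := by
    intro hMf
    have := Finset.ext_iff.1 heq f
    simp [hMf, h0] at this
  by_contra hne'
  rcases sign_cases h0 hne' hMf with h | h
  · exact hc f ⟨h.1 ▸ hF'.2.2 f, h.2 ▸ hM'.2.2 f⟩
  · exact hc f ⟨h.2 ▸ hM'.2.2 f, h.1 ▸ hF'.2.2 f⟩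

open Classical in
/-- A nonempty cell has Euler characteristic `1`: closed convex sets of covectors inside an open
half-space behave as if contractible. -/
theorem sum_cell {e : E} {s : SignType} (hs : s ≠ 0) {w : (E → SignType) → ℤ}
    (hw : ∀ F, F ∈ L.covectors ∧ F e = s →
      ∑ G with (G ∈ L.covectors ∧ G e = s) ∧ CovectorLE G F, w G = 1)
    {c : E → Set SignType} (h0 : ∀ f, 0 ∈ c f) (hne : (L.cell e s c).Nonempty) :
    ∑ F ∈ L.cell e s c, w F = 1 := by
  -- Induction on a set `S` containing all `f` for which `c f` allows both signs.
  suffices H : ∀ (S : Finset E) (c : E → Set SignType), (∀ f, 1 ∈ c f ∧ -1 ∈ c f → f ∈ S) →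
      (∀ f, 0 ∈ c f) → (L.cell e s c).Nonempty → ∑ F ∈ L.cell e s c, w F = 1 from
    H Finset.univ c (fun f _ => Finset.mem_univ f) h0 hne
  intro S
  induction S using Finset.induction_on with
  | empty =>
    intro c hc h0 hne
    obtain ⟨M, hM, hmax⟩ := exists_greatest_of_cell (fun f hf => by simpa using hc f hf) hne
    have hM' := mem_cell.1 hM
    rw [← hw M ⟨hM'.1, hM'.2.1⟩]
    refine Finset.sum_congr ?_ fun _ _ => rfl
    ext F
    simp only [Finset.mem_filter, Finset.mem_univ, true_and]
    constructor
    · intro hF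
      exact ⟨⟨(mem_cell.1 hF).1, (mem_cell.1 hF).2.1⟩, hmax F hF⟩
    · rintro ⟨⟨h1, h2⟩, h3⟩
      refine mem_cell.2 ⟨h1, h2, fun f => ?_⟩
      rcases h3 f with h | h
      · rw [h]
        exact h0 f
      · rw [h]
        exact hM'.2.2 f
  | insert f S hf ih =>
    intro c hc h0 hne
    have key : ∀ a : Set SignType, a ⊆ c f → 0 ∈ a → ¬ (1 ∈ a ∧ -1 ∈ a) →
        (L.cell e s (Function.update c f a)).Nonempty →
        ∑ F ∈ L.cell e s (Function.update c f a), w F = 1 := by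
      intro a ha ha0 hna
      refine ih _ (fun g hg => ?_) fun g => ?_
      · by_cases hgf : g = f
        · subst hgf
          exact absurd (by simpa using hg) hna
        · rw [Function.update_of_ne hgf] at hg
          exact Finset.mem_of_mem_insert_of_ne (hc g hg) hgf
      · by_cases hgf : g = f
        · subst hgf
          simpa using ha0
        · rw [Function.update_of_ne hgf]
          exact h0 g
    have hP : c f \ {-1} ⊆ c f := Set.sdiff_subset
    have hN : c f \ {1} ⊆ c f := Set.sdiff_subset
    have hZ : {0} ⊆ c f := by simpa using h0 f
    by_cases hpos : ∃ F ∈ L.cell e s c, F f = 1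
    · by_cases hneg : ∃ F ∈ L.cell e s c, F f = -1
      · obtain ⟨X, hX, hXf⟩ := hpos
        obtain ⟨Y, hY, hYf⟩ := hneg
        have hX' := mem_cell.1 hX
        have hY' := mem_cell.1 hY
        have hZne : (L.cell e s (Function.update c f {0})).Nonempty := by
          obtain ⟨Z, hZL, hZf, hZg⟩ := L.elim X hX'.1 Y hY'.1 f (by rw [hXf, hYf]; decide)
            (by rw [hXf]; decide)
          refine ⟨Z, (mem_cell_update hZ).2 ⟨mem_cell.2 ⟨hZL, ?_, fun g => ?_⟩, hZf⟩⟩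
          · rw [hZg e, hX'.2.1, hY'.2.1, ite_self]
            rw [hX'.2.1, hY'.2.1]
            have : ∀ s : SignType, s ≠ 0 → ¬ (s = -s ∧ s ≠ 0) := by decide
            exact this s hs
          · by_cases hg : X g = -Y g ∧ X g ≠ 0
            -- If `g` separates `X` and `Y`, then `c g` contains all signs.
            · have hXg := hX'.2.2 g
              have hYg := hY'.2.2 g
              have h0g := h0 g
              revert hg hXg hYg h0g
              generalize X g = x
              generalize Y g = y
              generalize Z g = z
              generalize c g = a
              rcases x <;> rcases y <;> rcases z <;> simp +contextual
            · rw [hZg g hg]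
              split_ifs
              exacts [hY'.2.2 g, hX'.2.2 g]
        have h1 := key _ hP ⟨h0 f, by decide⟩ (by simp)
          ⟨X, (mem_cell_update hP).2 ⟨hX, hX'.2.2 f, by rw [hXf]; decide⟩⟩
        have h2 := key _ hN ⟨h0 f, by decide⟩ (by simp)
          ⟨Y, (mem_cell_update hN).2 ⟨hY, hY'.2.2 f, by rw [hYf]; decide⟩⟩
        have h3 := key _ hZ rfl (by simp) hZne
        have hsum := Finset.sum_union_inter (f := w)
          (s₁ := L.cell e s (Function.update c f (c f \ {-1})))
          (s₂ := L.cell e s (Function.update c f (c f \ {1})))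
        have hU : L.cell e s (Function.update c f (c f \ {-1})) ∪
            L.cell e s (Function.update c f (c f \ {1})) = L.cell e s c := by
          ext F
          rw [Finset.mem_union, mem_cell_update hP, mem_cell_update hN, ← and_or_left]
          refine and_iff_left_of_imp fun hF => ?_
          have := (mem_cell.1 hF).2.2 f
          by_cases h : F f = 1
          · exact Or.inl ⟨this, by rw [h]; decide⟩
          · exact Or.inr ⟨this, h⟩
        have hI : L.cell e s (Function.update c f (c f \ {-1})) ∩
            L.cell e s (Function.update c f (c f \ {1}))
              = L.cell e s (Function.update c f {0}) := by
          ext F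
          rw [Finset.mem_inter, mem_cell_update hP, mem_cell_update hN, mem_cell_update hZ,
            ← and_and_left]
          refine and_congr_right fun hF => ?_
          have := (mem_cell.1 hF).2.2 f
          simp only [Set.mem_sdiff, this, true_and, Set.mem_singleton_iff]
          generalize F f = x
          revert x
          decide
        rw [hU, hI, h1, h2, h3] at hsum
        linarith
      · have hcell : L.cell e s c = L.cell e s (Function.update c f (c f \ {-1})) := by
          ext F
          rw [mem_cell_update hP]
          exact ⟨fun hF => ⟨hF, (mem_cell.1 hF).2.2 f, fun h => hneg ⟨F, hF, h⟩⟩, And.left⟩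
        rw [hcell] at hne ⊢
        exact key _ hP ⟨h0 f, by decide⟩ (by simp) hne
    · have hcell : L.cell e s c = L.cell e s (Function.update c f (c f \ {1})) := by
        ext F
        rw [mem_cell_update hN]
        exact ⟨fun hF => ⟨hF, (mem_cell.1 hF).2.2 f, fun h => hpos ⟨F, hF, h⟩⟩, And.left⟩
      rw [hcell] at hne ⊢
      exact key _ hN ⟨h0 f, by decide⟩ (by simp) hne

end Weight

/-! ### Topes and separators -/

section Separators

variable {E : Type*} {L : OrientedMatroid E}

theorem IsTope.comp {F R : E → SignType} (hF : F ∈ L.covectors) (hR : L.IsTope R) :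
    L.IsTope (fun f => if F f = 0 then R f else F f) := by
  refine ⟨L.comp_mem F hF R hR.1, fun X hX h => ?_⟩
  have hRX := hR.2 _ (L.comp_mem R hR.1 X hX) fun f => by
    by_cases hf : R f = 0
    · exact Or.inl hf
    · right
      simp [hf]
  funext f
  rcases h f with h0 | h0
  · dsimp only at h0
    have hFf : F f = 0 := by
      by_contra hFf
      rw [if_neg hFf] at h0
      exact hFf h0
    rw [if_pos hFf] at h0
    rw [if_pos hFf]
    have := congrFun hRX f
    simpa [h0] using this
  · exact h0.symm

theorem Tope.zero_iff (P Q : L.Tope) (f : E) : P.1 f = 0 ↔ Q.1 f = 0 :=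
  ⟨fun h => not_not.1 fun h' => P.2.ne_zero Q.2 h' h,
    fun h => not_not.1 fun h' => Q.2.ne_zero P.2 h' h⟩

theorem Tope.eq_of_ne_of_ne {P Q R : L.Tope} {f : E} (h1 : P.1 f ≠ Q.1 f) (h2 : Q.1 f ≠ R.1 f) :
    P.1 f = R.1 f := by
  have h3 := Tope.zero_iff P Q f
  have h4 := Tope.zero_iff Q R f
  revert h1 h2 h3 h4
  generalize P.1 f = p
  generalize Q.1 f = q
  generalize R.1 f = r
  revert p q r
  decide

theorem Tope.eq_neg_iff_ne {Q R : L.Tope} {e : E} (hR : R.1 e ≠ 0) :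
    Q.1 e = -R.1 e ↔ Q.1 e ≠ R.1 e := by
  have h := Tope.zero_iff Q R e
  revert h hR
  generalize Q.1 e = q
  generalize R.1 e = r
  revert q r
  decide

variable [Fintype E]

theorem mem_sep {X Y : E → SignType} {f : E} : f ∈ sep X Y ↔ X f = -Y f ∧ X f ≠ 0 := by
  simp [sep]

theorem sep_comm (X Y : E → SignType) : sep X Y = sep Y X := by
  ext f
  rw [mem_sep, mem_sep]
  generalize X f = x
  generalize Y f = y
  revert x y
  decide

theorem sep_neg_neg (X Y : E → SignType) : sep (-X) (-Y) = sep X Y := by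
  ext f
  simp only [mem_sep, Pi.neg_apply]
  generalize X f = x
  generalize Y f = y
  revert x y
  decide

theorem mem_sep_tope (P Q : L.Tope) (f : E) : f ∈ sep P.1 Q.1 ↔ P.1 f ≠ Q.1 f := by
  have h := Tope.zero_iff P Q f
  rw [mem_sep]
  revert h
  generalize P.1 f = p
  generalize Q.1 f = q
  revert p q
  decide

end Separators

/-! ### Möbius numbers of the topes beyond an element -/

section OppositeWeight

variable {E : Type*} [Fintype E] [DecidableEq E] {L : OrientedMatroid E}

/-- The number `-μ(0̂, Q)` in the poset of topes beyond `e`, seen from `R`; it is set to `0` for topes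
`Q` that do not belong to that poset. -/
noncomputable def oppositeWeight (R : L.Tope) (e : E) (Q : L.Tope) : ℤ :=
  if h : Q.1 e = -R.1 e then -L.moebius R e Q h else 0

open Classical in
theorem sum_oppositeTope (R : L.Tope) (e : E) [Fintype {T : L.TopePoset R // T.1 e = -R.1 e}]
    (Q : {T : L.TopePoset R // T.1 e = -R.1 e}) (h : L.Tope → ℤ) :
    ∑ T : {T : L.TopePoset R // T.1 e = -R.1 e} with T ≤ Q, h T.1 =
      ∑ T : L.Tope with T.1 e = -R.1 e ∧ sep R.1 T.1 ⊆ sep R.1 Q.1.1, h T := by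
  refine Finset.sum_bij (fun T _ => (T.1 : L.Tope)) ?_ ?_ ?_ fun _ _ => rfl
  · intro T hT
    exact Finset.mem_filter.2 ⟨Finset.mem_univ _, T.2, (Finset.mem_filter.1 hT).2⟩
  · intro T _ T' _ h
    exact Subtype.ext h
  · intro T hT
    have hT' := (Finset.mem_filter.1 hT).2
    exact ⟨⟨T, hT'.1⟩, Finset.mem_filter.2 ⟨Finset.mem_univ _, hT'.2⟩, rfl⟩

theorem sum_oppositeWeight_le (R : L.Tope) (e : E) (P : L.Tope) (hP : P.1 e = -R.1 e) :
    ∑ Q : L.Tope with Q.1 e = -R.1 e ∧ sep R.1 Q.1 ⊆ sep R.1 P.1, oppositeWeight R e Q = 1 := by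
  classical
  let _ : Fintype {T : L.TopePoset R // T.1 e = -R.1 e} := Fintype.ofFinite _
  have h1 := sum_oppositeTope R e ⟨P, hP⟩ (oppositeWeight R e)
  have h2 := sum_neg_mu_bot (⟨P, hP⟩ : {T : L.TopePoset R // T.1 e = -R.1 e})
  refine Eq.trans (by convert h1.symm) (Eq.trans (Finset.sum_congr rfl fun T _ => ?_) h2)
  have h3 : oppositeWeight R e T.1 = -L.moebius R e T.1 T.2 := dif_pos T.2
  rw [h3]
  unfold moebius
  congr!

/-- The weights `-μ(0̂, ·)` are characterized by their sums over principal lower sets. -/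
theorem eq_oppositeWeight (R : L.Tope) (e : E) (h : L.Tope → ℤ)
    (hh : ∀ P : L.Tope, P.1 e = -R.1 e →
      ∑ Q : L.Tope with Q.1 e = -R.1 e ∧ sep R.1 Q.1 ⊆ sep R.1 P.1, h Q = 1)
    (Q : L.Tope) (hQ : Q.1 e = -R.1 e) : h Q = oppositeWeight R e Q := by
  classical
  let _ : Fintype {T : L.TopePoset R // T.1 e = -R.1 e} := Fintype.ofFinite _
  refine congrFun (eq_of_sum_le_eq (α := {T : L.TopePoset R // T.1 e = -R.1 e})
    (f := fun T => h T.1) (g := fun T => oppositeWeight R e T.1) fun T => ?_) ⟨Q, hQ⟩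
  rw [sum_oppositeTope, sum_oppositeTope]
  have h1 := hh T.1 T.2
  have h2 := sum_oppositeWeight_le R e T.1 T.2
  refine Eq.trans (b := 1) ?_ ?_
  · convert h1
  · convert h2.symm

theorem oppositeWeight_neg (R : L.Tope) (e : E) (Q : L.Tope) (hQ : Q.1 e = -R.1 e) :
    oppositeWeight (-R) e (-Q) = oppositeWeight R e Q := by
  refine eq_oppositeWeight R e (fun Q => oppositeWeight (-R) e (-Q)) (fun P hP => ?_) Q hQ
  have hc : ∀ T : L.Tope, (-T).1 = -T.1 := fun _ => rfl
  rw [← sum_oppositeWeight_le (-R) e (-P) (by simp [hc, hP])]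
  refine Finset.sum_bij (fun T _ => -T) ?_ ?_ ?_ fun _ _ => rfl
  · intro T hT
    have hT' := (Finset.mem_filter.1 hT).2
    refine Finset.mem_filter.2 ⟨Finset.mem_univ _, ?_, ?_⟩
    · simp [hc, hT'.1]
    · simpa [hc, sep_neg_neg] using hT'.2
  · intro T _ T' _ h
    exact Subtype.ext (neg_injective (congrArg Subtype.val h))
  · intro T hT
    have hT' := (Finset.mem_filter.1 hT).2
    refine ⟨-T, Finset.mem_filter.2 ⟨Finset.mem_univ _, ?_, ?_⟩, Subtype.ext (neg_neg T.1)⟩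
    · simp [hc, hT'.1]
    · rw [← sep_neg_neg R.1, ← sep_neg_neg R.1]
      simpa [hc] using hT'.2

/-- The topes beyond `e` in a cone around `R` form a poset of Euler characteristic `1`, provided that
there are any. The proof pushes a weight on covectors forward along `F ↦ F ∘ R`. -/
theorem sum_oppositeWeight (R : L.Tope) (e : E) (hR : R.1 e ≠ 0) (B : Finset E) (P : L.Tope)
    (hP : P.1 e = -R.1 e) (hPB : sep R.1 P.1 ⊆ B) :
    ∑ Q : L.Tope with Q.1 e = -R.1 e ∧ sep R.1 Q.1 ⊆ B, oppositeWeight R e Q = 1 := by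
  classical
  obtain ⟨w, hw⟩ := exists_weight fun F => F ∈ L.covectors ∧ F e = -R.1 e
  let g : (E → SignType) → L.Tope := fun F => if hF : F ∈ L.covectors then ⟨_, R.2.comp hF⟩ else R
  have hg : ∀ F ∈ L.covectors, ∀ f, (g F).1 f = if F f = 0 then R.1 f else F f := by
    intro F hF f
    simp only [g, dif_pos hF]
  let h : L.Tope → ℤ := fun Q => ∑ F with (F ∈ L.covectors ∧ F e = -R.1 e) ∧ g F = Q, w F
  have key : ∀ (B : Finset E) (P : L.Tope), P.1 e = -R.1 e → sep R.1 P.1 ⊆ B →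
      ∑ Q : L.Tope with Q.1 e = -R.1 e ∧ sep R.1 Q.1 ⊆ B, h Q = 1 := by
    intro B P hP hPB
    -- `F ∘ R` lies in the cone of `B` exactly if `F f ∈ c f` for all `f`.
    let c : E → Set SignType := fun f => {s | R.1 f = -s ∧ R.1 f ≠ 0 → f ∈ B}
    have hcell : ∀ F, F ∈ L.cell e (-R.1 e) c ↔
        F ∈ L.covectors ∧ F e = -R.1 e ∧ sep R.1 F ⊆ B := by
      intro F
      rw [mem_cell]
      refine and_congr_right fun _ => and_congr_right fun _ => ?_
      simp only [c, Set.mem_ofPred_eq, Finset.subset_iff, mem_sep]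
    have hsep : ∀ F ∈ L.covectors, sep R.1 (g F).1 = sep R.1 F := by
      intro F hF
      ext f
      rw [mem_sep, mem_sep, hg F hF]
      generalize R.1 f = r
      generalize F f = x
      revert r x
      decide
    have hge : ∀ F ∈ L.covectors, ((g F).1 e = -R.1 e ↔ F e = -R.1 e) := by
      intro F hF
      rw [hg F hF]
      revert hR
      generalize R.1 e = r
      generalize F e = x
      revert r x
      decide
    rw [← sum_cell (L := L) (e := e) (s := -R.1 e) (w := w) (by simpa using hR)
      (fun F hF => by convert hw F hF) (c := c)
      (fun f h => absurd (by simpa using h.1) h.2) ⟨P.1, (hcell _).2 ⟨P.2.1, hP, hPB⟩⟩]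
    rw [← Finset.sum_fiberwise_of_maps_to (g := g)
      (t := Finset.univ.filter fun Q : L.Tope => Q.1 e = -R.1 e ∧ sep R.1 Q.1 ⊆ B)]
    · refine Finset.sum_congr rfl fun Q hQ => Finset.sum_congr ?_ fun _ _ => rfl
      have hQ' := (Finset.mem_filter.1 hQ).2
      ext F
      simp only [Finset.mem_filter, Finset.mem_univ, true_and, hcell]
      constructor
      · rintro ⟨⟨h1, h2⟩, h3⟩
        refine ⟨⟨h1, h2, ?_⟩, h3⟩
        rw [← hsep F h1, h3]
        exact hQ'.2
      · rintro ⟨⟨h1, h2, _⟩, h3⟩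
        exact ⟨⟨h1, h2⟩, h3⟩
    · intro F hF
      obtain ⟨h1, h2, h3⟩ := (hcell F).1 hF
      refine Finset.mem_filter.2 ⟨Finset.mem_univ _, (hge F h1).2 h2, ?_⟩
      rwa [hsep F h1]
  rw [← key B P hP hPB]
  refine Finset.sum_congr rfl fun Q hQ => ?_
  exact (eq_oppositeWeight R e h (fun P hP => key _ P hP subset_rfl) Q
    (Finset.mem_filter.1 hQ).2.1).symm

/-- Sorting the topes `Q` by `D = Sep(R,Q) \ Sep(R,P)`, only `D = ∅` contributes to the sum. -/
theorem sum_oppositeWeight_mul_prod {S : Type*} [CommRing S] (x : E → S) (R : L.Tope) (e : E)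
    (hR : R.1 e ≠ 0) (B : Finset E) (P : L.Tope) (hP : P.1 e = -R.1 e) (hPB : sep R.1 P.1 ⊆ B) :
    ∑ Q : L.Tope with Q.1 e = -R.1 e ∧ sep R.1 Q.1 ⊆ B,
      (oppositeWeight R e Q : S) * ∏ f ∈ sep R.1 Q.1 \ sep R.1 P.1, x f = 1 := by
  classical
  let a : Finset E → ℤ := fun D =>
    ∑ Q : L.Tope with Q.1 e = -R.1 e ∧ sep R.1 Q.1 \ sep R.1 P.1 = D, oppositeWeight R e Q
  have ha : a = fun D => if D = ∅ then 1 else 0 := by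
    refine eq_of_sum_le_eq fun D => ?_
    have h1 := sum_oppositeWeight R e hR (sep R.1 P.1 ∪ D) P hP Finset.subset_union_left
    rw [← Finset.sum_fiberwise_of_maps_to (g := fun Q : L.Tope => sep R.1 Q.1 \ sep R.1 P.1)
      (t := Finset.univ.filter fun D' => D' ≤ D)] at h1
    · rw [Finset.sum_ite_eq_of_mem' _ _ _ (by simp), ← h1]
      refine Finset.sum_congr (by ext; simp) fun D' hD' => Finset.sum_congr ?_ fun _ _ => rfl
      have hD := (Finset.mem_filter.1 hD').2
      ext Q
      simp only [Finset.mem_filter, Finset.mem_univ, true_and]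
      constructor
      · rintro ⟨h1, h2⟩
        refine ⟨⟨h1, ?_⟩, h2⟩
        refine sdiff_le_iff.1 ?_
        rw [h2]
        exact hD
      · rintro ⟨⟨h1, _⟩, h2⟩
        exact ⟨h1, h2⟩
    · intro Q hQ
      refine Finset.mem_filter.2 ⟨Finset.mem_univ _, ?_⟩
      exact sdiff_le_iff.2 (Finset.mem_filter.1 hQ).2.2
  rw [← Finset.sum_fiberwise_of_maps_to (g := fun Q : L.Tope => sep R.1 Q.1 \ sep R.1 P.1)
      (t := B.powerset)]
  · calc _ = ∑ D ∈ B.powerset, (a D : S) * ∏ f ∈ D, x f := by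
          refine Finset.sum_congr rfl fun D hD => ?_
          rw [Int.cast_sum, Finset.sum_mul, Finset.filter_filter]
          refine Finset.sum_congr ?_ fun Q hQ => ?_
          · ext Q
            simp only [Finset.mem_filter, Finset.mem_univ, true_and]
            constructor
            · rintro ⟨⟨h1, _⟩, h2⟩
              exact ⟨h1, h2⟩
            · rintro ⟨h1, h2⟩
              refine ⟨⟨h1, ?_⟩, h2⟩
              rw [← Finset.union_eq_right.2 hPB]
              refine sdiff_le_iff.1 ?_
              rw [h2]
              exact Finset.mem_powerset.1 hD
          · rw [(Finset.mem_filter.1 hQ).2.2]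
      _ = 1 := by
          rw [ha, Finset.sum_eq_single ∅]
          · simp
          · intro D _ hD
            simp [hD]
          · intro h
            exact absurd (Finset.empty_mem_powerset B) h
  · intro Q hQ
    exact Finset.mem_powerset.2 (Finset.sdiff_subset.trans (Finset.mem_filter.1 hQ).2.2)

end OppositeWeight

/-! ### Factorization of the truncated Varchenko matrices -/

section Factorization

variable (K : Type*) [Field K] {E : Type*} [Fintype E] [LinearOrder E] {L : OrientedMatroid E}

theorem varchenko_mul_varchenko (P Q R : L.Tope) :
    L.varchenko K P Q * L.varchenko K Q R =
      L.varchenko K P R * ∏ f ∈ sep R.1 Q.1 \ sep R.1 P.1, MvPolynomial.X f ^ 2 := by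
  have hs : ∀ P Q : L.Tope, sep P.1 Q.1 = Finset.univ.filter fun f => P.1 f ≠ Q.1 f := by
    intro P Q
    ext f
    simp [mem_sep_tope]
  have hd : sep R.1 Q.1 \ sep R.1 P.1 =
      Finset.univ.filter fun f => R.1 f ≠ Q.1 f ∧ R.1 f = P.1 f := by
    ext f
    simp [mem_sep_tope]
  rw [hd]
  simp only [varchenko, hs, Finset.prod_filter]
  rw [← Finset.prod_mul_distrib, ← Finset.prod_mul_distrib]
  refine Finset.prod_congr rfl fun f _ => ?_
  by_cases h1 : P.1 f = Q.1 f
  · by_cases h2 : Q.1 f = R.1 f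
    · simp [h1, h2]
    · simp [h1, h2, Ne.symm h2]
  · by_cases h2 : Q.1 f = R.1 f
    · simp [h1, ← h2]
    · have h3 := Tope.eq_of_ne_of_ne h1 h2
      simp [h3, h2, Ne.symm h2, sq]

open Classical in
/-- Both off-diagonal blocks of the factor are given by the same formula, because `T ↦ -T` preserves
the weights and the separators. -/
theorem factor_apply_of_ne {e : E} {Q R : L.Tope} (h : Q.1 e ≠ R.1 e) :
    L.factor K e Q R = if IsGreatest (sep Q.1 R.1 : Set E) e then
      (oppositeWeight R e Q : MvPolynomial E K) * L.varchenko K Q R else 0 := by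
  have hs := (mem_sep.1 ((mem_sep_tope Q R e).2 h))
  have hc : ∀ T : L.Tope, (-T).1 = -T.1 := fun _ => rfl
  by_cases h1 : Q.1 e = 1
  · have h2 : R.1 e = -1 := by
      rw [← neg_neg (R.1 e), ← hs.1, h1]
    have h3 := oppositeWeight_neg R e Q hs.1
    rw [factor, dif_neg (fun h => absurd (h1.symm.trans h.1) (by decide)), dif_pos ⟨h1, h2⟩,
      block, ← h3, oppositeWeight,
      dif_pos (by simp [hc, hs.1])]
    simp only [hc, sep_neg_neg, varchenko, Int.cast_neg]
  · have h1' : Q.1 e = -1 := by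
      have := hs.2
      revert h1 this
      generalize Q.1 e = q
      revert q
      decide
    have h2 : R.1 e = 1 := by
      rw [← neg_neg (R.1 e), ← hs.1, h1', neg_neg]
    rw [factor, dif_pos ⟨h1', h2⟩, block, oppositeWeight, dif_pos hs.1]
    simp only [Int.cast_neg]

open Classical in
theorem factor_apply_of_eq {e : E} {Q R : L.Tope} (h : Q.1 e = R.1 e) :
    L.factor K e Q R = if Q = R then 1 else 0 := by
  rw [factor, dif_neg, dif_neg]
  · rintro ⟨h1, h2⟩
    rw [h1, h2] at h
    exact absurd h (by decide)
  · rintro ⟨h1, h2⟩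
    rw [h1, h2] at h
    exact absurd h (by decide)

/-- The Varchenko matrix with the indeterminates outside `S` set to zero. -/
noncomputable def truncatedVarchenko (L : OrientedMatroid E) (S : Finset E) :
    Matrix L.Tope L.Tope (MvPolynomial E K) :=
  fun P Q => if sep P.1 Q.1 ⊆ S then L.varchenko K P Q else 0

theorem truncatedVarchenko_mul_factor (e : E) :
    truncatedVarchenko K L (Finset.univ.filter (· < e)) * L.factor K e =
      truncatedVarchenko K L (Finset.univ.filter (· ≤ e)) := by
  classical
  ext1 P R
  rw [Matrix.mul_apply]
  by_cases hPR : P.1 e = R.1 e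
  · rw [Finset.sum_eq_single R]
    · rw [factor_apply_of_eq K rfl, if_pos rfl, mul_one, truncatedVarchenko, truncatedVarchenko]
      refine if_congr ?_ rfl rfl
      simp only [Finset.subset_iff, Finset.mem_filter, Finset.mem_univ, true_and, mem_sep_tope]
      refine forall_congr' fun f => imp_congr_right fun hf => ?_
      refine ⟨le_of_lt, fun h => lt_of_le_of_ne h ?_⟩
      rintro rfl
      exact hf hPR
    · intro Q _ hQ
      by_cases hQR : Q.1 e = R.1 e
      · rw [factor_apply_of_eq K hQR, if_neg hQ, mul_zero]
      · rw [truncatedVarchenko, if_neg, zero_mul]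
        intro hsub
        have := hsub ((mem_sep_tope P Q e).2 (by rw [hPR]; exact Ne.symm hQR))
        simp at this
    · intro h
      exact absurd (Finset.mem_univ R) h
  · have hs := mem_sep.1 ((mem_sep_tope P R e).2 hPR)
    have hR : R.1 e ≠ 0 := R.2.ne_zero P.2 hs.2
    -- The two truncations on the left combine to the one on the right: if `Q` lies on the side of `P`
    -- and `Sep(Q,R) ⊆ {f | f ≤ e}`, then `Sep(P,Q) ⊆ {f | f < e}` iff `Sep(P,R) ⊆ {f | f ≤ e}`.
    have hterm : ∀ Q : L.Tope,
        truncatedVarchenko K L (Finset.univ.filter (· < e)) P Q * L.factor K e Q R =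
          if Q.1 e = -R.1 e ∧ sep R.1 Q.1 ⊆ Finset.univ.filter (· ≤ e) then
            truncatedVarchenko K L (Finset.univ.filter (· ≤ e)) P R *
              ((oppositeWeight R e Q : MvPolynomial E K) *
                ∏ f ∈ sep R.1 Q.1 \ sep R.1 P.1, MvPolynomial.X f ^ 2) else 0 := by
      intro Q
      simp only [Tope.eq_neg_iff_ne hR]
      by_cases hQR : Q.1 e = R.1 e
      · rw [if_neg (fun h => h.1 hQR), truncatedVarchenko, if_neg, zero_mul]
        intro hsub
        have := hsub ((mem_sep_tope P Q e).2 (by rw [hQR]; exact hPR))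
        simp at this
      · have hPQ : P.1 e = Q.1 e := Tope.eq_of_ne_of_ne hPR (Ne.symm hQR)
        have hgr : IsGreatest (sep Q.1 R.1 : Set E) e ↔
            sep R.1 Q.1 ⊆ Finset.univ.filter (· ≤ e) := by
          rw [sep_comm R.1]
          refine (and_iff_right (by simpa [mem_sep_tope] using hQR)).trans ?_
          simp [mem_upperBounds, Finset.subset_iff]
        rw [factor_apply_of_ne K hQR]
        by_cases hle : sep R.1 Q.1 ⊆ Finset.univ.filter (· ≤ e)
        · rw [if_pos (hgr.2 hle), if_pos ⟨hQR, hle⟩, truncatedVarchenko, truncatedVarchenko]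
          have hiff : sep P.1 Q.1 ⊆ Finset.univ.filter (· < e) ↔
              sep P.1 R.1 ⊆ Finset.univ.filter (· ≤ e) := by
            simp only [Finset.subset_iff, Finset.mem_filter, Finset.mem_univ, true_and,
              mem_sep_tope] at hle ⊢
            constructor
            · intro h f hf
              by_cases hfQ : P.1 f = Q.1 f
              · exact hle (fun h' => hf (hfQ.trans h'.symm))
              · exact (h hfQ).le
            · intro h f hf
              refine lt_of_le_of_ne ?_ ?_
              · by_cases hfR : P.1 f = R.1 f
                · exact hle (fun h' => hf (hfR.trans h'))
                · exact h hfR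
              · rintro rfl
                exact hf hPQ
          by_cases hPR' : sep P.1 R.1 ⊆ Finset.univ.filter (· ≤ e)
          · rw [if_pos (hiff.2 hPR'), if_pos hPR', mul_left_comm, varchenko_mul_varchenko,
              mul_left_comm]
          · rw [if_neg (fun h => hPR' (hiff.1 h)), if_neg hPR', zero_mul, zero_mul]
        · rw [if_neg (fun h => hle (hgr.1 h)), if_neg (fun h => hle h.2), mul_zero]
    rw [Finset.sum_congr rfl fun Q _ => hterm Q, ← Finset.sum_filter, ← Finset.mul_sum]
    by_cases hPR' : sep P.1 R.1 ⊆ Finset.univ.filter (· ≤ e)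
    · rw [sum_oppositeWeight_mul_prod _ R e hR _ P hs.1 (by rwa [sep_comm]), mul_one]
    · rw [truncatedVarchenko, if_neg hPR', zero_mul]

theorem truncatedVarchenko_empty [DecidableEq L.Tope] : truncatedVarchenko K L ∅ = 1 := by
  ext1 P Q
  rw [truncatedVarchenko, Matrix.one_apply]
  by_cases h : P = Q
  · subst h
    have : sep P.1 P.1 = ∅ := by
      ext f
      simp [mem_sep_tope]
    simp [this, varchenko]
  · rw [if_neg h, if_neg]
    intro hsub
    refine h (Subtype.ext (funext fun f => not_not.1 fun hf => ?_))
    exact Finset.notMem_empty f (hsub ((mem_sep_tope P Q f).2 hf))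

theorem truncatedVarchenko_univ : truncatedVarchenko K L Finset.univ = L.varchenko K := by
  ext1 P Q
  rw [truncatedVarchenko, if_pos (Finset.subset_univ _)]

end Factorization

end OrientedMatroid

theorem proposition5p3 {K : Type*} [Field K] {E : Type*} [Fintype E] [LinearOrder E]
    (L : OrientedMatroid E) (r : ℕ) (e : Fin r ≃o E) :
    L.varchenko K = (List.ofFn fun i : Fin r => L.factor K (e i)).prod := by
  have h : ∀ k ≤ r, ((List.ofFn fun i : Fin r => L.factor K (e i)).take k).prod =
      OrientedMatroid.truncatedVarchenko K L
        (Finset.univ.filter fun f => (e.symm f : ℕ) < k) := by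
    intro k
    induction k with
    | zero =>
      intro _
      simp [OrientedMatroid.truncatedVarchenko_empty]
    | succ k ih =>
      intro hk
      have h1 : (Finset.univ.filter fun f => (e.symm f : ℕ) < k) =
          Finset.univ.filter (· < e ⟨k, hk⟩) := by
        ext f
        simp [← e.symm.lt_iff_lt, Fin.lt_def]
      have h2 : (Finset.univ.filter fun f => (e.symm f : ℕ) < k + 1) =
          Finset.univ.filter (· ≤ e ⟨k, hk⟩) := by
        ext f
        simp [← e.symm.le_iff_le, Fin.le_def]
      rw [List.prod_take_succ _ k (by simpa using hk), ih (Nat.le_of_succ_le hk), h1, h2,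
        List.getElem_ofFn, OrientedMatroid.truncatedVarchenko_mul_factor]
  have hr := h r le_rfl
  rw [List.take_of_length_le (by simp)] at hr
  rw [hr, ← OrientedMatroid.truncatedVarchenko_univ]
  congr 1
  ext f
  simp
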